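/- Let $K$ be a field and let $A$ be an associative, not necessarily unital, $K$-algebra that is s-unital, i.e. for every $x\in A$ there are $u,v\in A$ with $ux=x=xv$. Let $E=(E^0,E^1,r,s)$ be a directed graph with countable vertex set $E^0$ and countable edge set $E^1$ which is row-finite, i.e. every vertex emits only finitely many edges. Suppose that: (i) every nonzero right ideal in every quotient $A/I$ of $A$ by a two-sided ideal $I$ contains a nonzero idempotent; (ii) the only hereditary and saturated subsets of $E^0$ are $\varnothing$ and $E^0$; (iii) every cycle in $E$ has an exit; (iv) every vertex of $E$ connects to a cycle, i.e. there is a (possibly trivial) path from it to a vertex on a cycle. Then the algebra $R=A\otimes_K L_K(E)$ is properly purely infinite: every nonzero $a\in R$ is properly infinite, i.e. there are $\alpha\in M_{2\times 1}(R)$ and $\beta\in M_{1\times 2}(R)$ with $$\begin{pmatrix} a&0\\0&a\end{pmatrix}=\alpha\, a\,\beta .$$ Here a set $H\subseteq E^0$ is hereditary if $w\in H$ whenever $v\in H$ and there is a path from $v$ to $w$. It is saturated if every vertex $v$ that emits at least one edge and satisfies $r(e)\in H$ for all $e\in s^{-1}(v)$ belongs to $H$. A cycle is a path $e_1\cdots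 e_n$ ($n\ge 1$) with $r(e_n)=s(e_1)$ and $s(e_i)\ne s(e_j)$ for $i\neq j$; an exit for it is an edge $e$ such that $s(e)=s(e_i)$ and $e\ne e_i$ for some $i$. The Leavitt path algebra $L_K(E)$ is the (not necessarily unital) $K$-algebra generated by $E^0\cup E^1\cup\{e^*: e\in E^1\}$ subject to the relations $vw=\delta_{v,w}v$ for $v,w\in E^0$; $s(e)e=e\,r(e)=e$ and $r(e)e^*=e^*s(e)=e^*$ for $e\in E^1$; $e^*f=\delta_{e,f}\,r(e)$ for $e,f\in E^1$; and $v=\sum_{e\in s^{-1}(v)}ee^*$ for every $v\in E^0$ that emits at least one edge. -/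

import Mathlib

open scoped TensorProduct

/-! ### Rings that need not have a unit -/

/-- A (not necessarily unital) ring is s-unital if every element `x` satisfies `u x = x = x v` for
some `u, v` in the ring. -/
def IsSUnital (R : Type*) [NonUnitalRing R] : Prop :=
  ∀ x : R, ∃ u v : R, u * x = x ∧ x * v = x

/-- An additive subgroup of a (not necessarily unital) ring is a right ideal if it is closed under
right multiplication by elements of the ring. -/
def IsRightIdeal {R : Type*} [NonUnitalRing R] (J : AddSubgroup R) : Prop :=
  ∀ x ∈ J, ∀ r : R, x * r ∈ J

/-- Every nonzero right ideal of the ring contains a nonzero idempotent. -/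
def RightIdealsHaveIdempotents (R : Type*) [NonUnitalRing R] : Prop :=
  ∀ J : AddSubgroup R, IsRightIdeal J → J ≠ ⊥ → ∃ e ∈ J, e ≠ 0 ∧ e * e = e

/-- The relation `x ≾ y` between square matrices (of possibly different sizes) over a ring:
`x = α y β` for some rectangular matrices `α`, `β` over the ring. -/
def MatrixPrecsim {R : Type*} [NonUnitalRing R] {ι κ : Type*} [Fintype ι] [Fintype κ]
    (x : Matrix ι ι R) (y : Matrix κ κ R) : Prop :=
  ∃ (α : Matrix ι κ R) (β : Matrix κ ι R), x = α * y * β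

/-- The block sum `x ⊕ y` of square matrices. -/
def blockSum {R : Type*} [NonUnitalRing R] {ι κ : Type*}
    (x : Matrix ι ι R) (y : Matrix κ κ R) : Matrix (ι ⊕ κ) (ι ⊕ κ) R :=
  Matrix.fromBlocks x 0 0 y

/-- An element of a ring, viewed as a `1 × 1` matrix. -/
def oneByOne {R : Type*} (a : R) : Matrix (Fin 1) (Fin 1) R :=
  Matrix.of fun _ _ => a

/-- `a` is properly infinite if `a ≠ 0` and `a ⊕ a ≾ a`. -/
def IsProperlyInfinite {R : Type*} [NonUnitalRing R] (a : R) : Prop :=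
  a ≠ 0 ∧ MatrixPrecsim (blockSum (oneByOne a) (oneByOne a)) (oneByOne a)

/-- A ring is properly purely infinite if each of its nonzero elements is properly infinite. -/
def IsProperlyPurelyInfinite (R : Type*) [NonUnitalRing R] : Prop :=
  ∀ a : R, a ≠ 0 → IsProperlyInfinite a

/-! ### Directed graphs -/

/-- A directed graph with vertex set `V` and edge set `W`; loops and parallel edges are allowed. -/
structure DirectedGraph (V W : Type*) where
  /-- the source of an edge -/
  s : W → V
  /-- the range of an edge -/
  r : W → V

namespace DirectedGraph

variable {V W : Type*} (E : DirectedGraph V W)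

/-- Every vertex emits only finitely many edges. -/
def RowFinite : Prop := ∀ v : V, {e : W | E.s e = v}.Finite

/-- `E.IsPath v p w`: the list of edges `p` is a path from `v` to `w`; the empty list is the trivial
path at a vertex. -/
def IsPath : V → List W → V → Prop
  | v, [], w => v = w
  | v, e :: p, w => E.s e = v ∧ IsPath (E.r e) p w

/-- There is a path from `v` to `w`. -/
def Connects (v w : V) : Prop := ∃ p : List W, E.IsPath v p w

/-- A cycle is a path of positive length from a vertex to itself whose edges have pairwise distinct
sources. -/
def IsCycle (p : List W) : Prop :=
  p ≠ [] ∧ (∃ v, E.IsPath v p v) ∧ (p.map E.s).Nodup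

/-- The edge `e` is an exit for the path `p`. -/
def IsExit (e : W) (p : List W) : Prop := ∃ f ∈ p, E.s e = E.s f ∧ e ≠ f

/-- There is a path from `v` to some vertex of some cycle. -/
def ConnectsToCycle (v : V) : Prop := ∃ p, E.IsCycle p ∧ ∃ f ∈ p, E.Connects v (E.s f)

/-- Sets of vertices closed under following paths. -/
def IsHereditary (H : Set V) : Prop := ∀ v w, E.Connects v w → v ∈ H → w ∈ H

/-- Every vertex that emits an edge and all of whose edges end in `H` belongs to `H`. -/
def IsSaturated (H : Set V) : Prop :=
  ∀ v, (∃ e, E.s e = v) → (∀ e, E.s e = v → E.r e ∈ H) → v ∈ H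

end DirectedGraph

/-! ### Leavitt path algebras -/

/-- The generators of a Leavitt path algebra: vertices, edges and ghost edges `e*`. -/
inductive LeavittGenerator (V W : Type*)
  | vertex (v : V)
  | edge (e : W)
  | ghost (e : W)

/-- The free associative, not necessarily unital, `K`-algebra on the generators: the semigroup
algebra of the free semigroup. -/
abbrev FreeLeavitt (K V W : Type*) [Field K] : Type _ :=
  MonoidAlgebra K (FreeSemigroup (LeavittGenerator V W))

namespace FreeLeavitt

variable (K : Type*) [Field K] {V W : Type*}

/-- A vertex as an element of the free algebra. -/
noncomputable def vertex (v : V) : FreeLeavitt K V W :=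
  MonoidAlgebra.single (FreeSemigroup.of (LeavittGenerator.vertex v)) 1

/-- A real edge as an element of the free algebra. -/
noncomputable def edge (e : W) : FreeLeavitt K V W :=
  MonoidAlgebra.single (FreeSemigroup.of (LeavittGenerator.edge e)) 1

/-- A ghost edge as an element of the free algebra. -/
noncomputable def ghost (e : W) : FreeLeavitt K V W :=
  MonoidAlgebra.single (FreeSemigroup.of (LeavittGenerator.ghost e)) 1

end FreeLeavitt

open FreeLeavitt in
/-- The defining relations of the Leavitt path algebra. In the last one the vertex `v` is not a
sink and emits finitely many edges. -/
inductive LeavittRel (K : Type*) [Field K] {V W : Type*} (E : DirectedGraph V W) :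
    FreeLeavitt K V W → FreeLeavitt K V W → Prop
  | vertex_mul_self (v : V) : LeavittRel K E (vertex K v * vertex K v) (vertex K v)
  | vertex_mul_ne (v w : V) (h : v ≠ w) : LeavittRel K E (vertex K v * vertex K w) 0
  | source_mul_edge (e : W) : LeavittRel K E (vertex K (E.s e) * edge K e) (edge K e)
  | edge_mul_range (e : W) : LeavittRel K E (edge K e * vertex K (E.r e)) (edge K e)
  | range_mul_ghost (e : W) : LeavittRel K E (vertex K (E.r e) * ghost K e) (ghost K e)
  | ghost_mul_source (e : W) : LeavittRel K E (ghost K e * vertex K (E.s e)) (ghost K e)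
  | ghost_mul_self (e : W) : LeavittRel K E (ghost K e * edge K e) (vertex K (E.r e))
  | ghost_mul_ne (e f : W) (h : e ≠ f) : LeavittRel K E (ghost K e * edge K f) 0
  | vertex_eq_sum (v : V) (hne : ∃ e, E.s e = v) (hfin : {e : W | E.s e = v}.Finite) :
      LeavittRel K E (vertex K v) (∑ e ∈ hfin.toFinset, edge K e * ghost K e)

section LeavittPathAlgebra

variable (K : Type*) [Field K] {V W : Type*} (E : DirectedGraph V W)

/-- The algebra ideal of relations: the smallest two-sided ideal that is closed under scalars and
contains `a - b` for every defining relation `a = b`. -/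
noncomputable def leavittIdeal : TwoSidedIdeal (FreeLeavitt K V W) :=
  sInf {I | (∀ (k : K), ∀ x ∈ I, k • x ∈ I) ∧ ∀ a b, LeavittRel K E a b → a - b ∈ I}

theorem leavittIdeal_smul_mem (k : K) {x : FreeLeavitt K V W} (hx : x ∈ leavittIdeal K E) :
    k • x ∈ leavittIdeal K E := by
  rw [leavittIdeal, TwoSidedIdeal.mem_sInf] at hx ⊢
  exact fun I hI => hI.1 k x (hx I hI)

/-- The Leavitt path algebra `L_K(E)`. -/
def LeavittPathAlgebra : Type _ := (leavittIdeal K E).ringCon.Quotient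

noncomputable instance : NonUnitalRing (LeavittPathAlgebra K E) :=
  inferInstanceAs (NonUnitalRing (leavittIdeal K E).ringCon.Quotient)

/-- The quotient map from the free algebra. -/
noncomputable def LeavittPathAlgebra.mk : FreeLeavitt K V W →+ LeavittPathAlgebra K E where
  toFun x := ((x : (leavittIdeal K E).ringCon.Quotient) : LeavittPathAlgebra K E)
  map_zero' := rfl
  map_add' _ _ := rfl

theorem LeavittPathAlgebra.mk_surjective : Function.Surjective (LeavittPathAlgebra.mk K E) :=
  Quotient.mk''_surjective

theorem LeavittPathAlgebra.mk_mul (x y : FreeLeavitt K V W) :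
    mk K E (x * y) = mk K E x * mk K E y := rfl

noncomputable instance : SMul K (LeavittPathAlgebra K E) where
  smul k := Quotient.map' (k • ·) fun x y h => by
    have h' : x - y ∈ leavittIdeal K E := (TwoSidedIdeal.rel_iff _ x y).1 h
    refine (TwoSidedIdeal.rel_iff (leavittIdeal K E) (k • x) (k • y)).2 ?_
    rw [← smul_sub]
    exact leavittIdeal_smul_mem K E k h'

theorem LeavittPathAlgebra.mk_smul (k : K) (x : FreeLeavitt K V W) :
    mk K E (k • x) = k • mk K E x := rfl

noncomputable instance : Module K (LeavittPathAlgebra K E) :=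
  (LeavittPathAlgebra.mk_surjective K E).module K (LeavittPathAlgebra.mk K E)
    (LeavittPathAlgebra.mk_smul K E)

instance : IsScalarTower K (LeavittPathAlgebra K E) (LeavittPathAlgebra K E) where
  smul_assoc k x y := by
    obtain ⟨x, rfl⟩ := LeavittPathAlgebra.mk_surjective K E x
    obtain ⟨y, rfl⟩ := LeavittPathAlgebra.mk_surjective K E y
    simp only [smul_eq_mul, ← LeavittPathAlgebra.mk_smul, ← LeavittPathAlgebra.mk_mul,
      smul_mul_assoc]

instance : SMulCommClass K (LeavittPathAlgebra K E) (LeavittPathAlgebra K E) where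
  smul_comm k x y := by
    obtain ⟨x, rfl⟩ := LeavittPathAlgebra.mk_surjective K E x
    obtain ⟨y, rfl⟩ := LeavittPathAlgebra.mk_surjective K E y
    simp only [smul_eq_mul, ← LeavittPathAlgebra.mk_smul, ← LeavittPathAlgebra.mk_mul,
      mul_smul_comm]

end LeavittPathAlgebra

/-! ### Rings with local units -/

/-! Write N(a) for the set of all x with a ⊕ x ≾ a. In an s-unital ring it is a two-sided ideal
(`absorbedIdeal`), and a nonzero a is properly infinite as soon as a ∈ N(a). If a ∉ N(a), it
suffices to compress a, modulo N(a), to a nonzero properly infinite idempotent e. Then a absorbs e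
modulo N(a), and the errors of this congruence are themselves absorbed by a, so e lifts into N(a), a
contradiction. This is `isProperlyPurelyInfinite_of_idempotents`.

For A ⊗ L_K(E) the compression is made modulo an arbitrary ideal N. The graph conditions give a
vertex w that every vertex reaches and that emits two edges. Given x ∉ N, right multiplication by a
long path removes all ghost edges and leaves a polynomial in real paths. Ghost edges on the left
strip it until its constant term b ⊗ v lies outside N. Conjugation by well-chosen paths kills the
other terms and moves the constant term to b ⊗ w (`exists_compression`), which stays outside N
because the vertices u with b ⊗ u ∈ N form a hereditary saturated set. The idempotent hypothesis on
A then replaces b by some e that is idempotent modulo the coefficients of N at w. Two closed paths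
at w, neither a prefix of the other, make e ⊗ w properly infinite modulo N. -/

theorem TwoSidedIdeal.coe_eq_coe_iff {R : Type*} [NonUnitalRing R] (N : TwoSidedIdeal R) (x y : R) :
    (x : N.ringCon.Quotient) = y ↔ x - y ∈ N := by
  rw [RingCon.eq, TwoSidedIdeal.rel_iff]

theorem TwoSidedIdeal.coe_eq_zero_iff {R : Type*} [NonUnitalRing R] (N : TwoSidedIdeal R) (x : R) :
    (x : N.ringCon.Quotient) = 0 ↔ x ∈ N := by
  rw [← RingCon.coe_zero, N.coe_eq_coe_iff, sub_zero]

/-- In a ring with right units for elements, finite sets have common right units. -/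
theorem exists_common_right_unit {R : Type*} [NonUnitalRing R] (h : ∀ x : R, ∃ v : R, x * v = x)
    (S : Finset R) : ∃ v : R, ∀ x ∈ S, x * v = x := by
  classical
  induction S using Finset.induction_on with
  | empty => exact ⟨0, by simp⟩
  | insert y S _ ih =>
    obtain ⟨v, hv⟩ := ih
    obtain ⟨w, hw⟩ := h (y - y * v)
    refine ⟨v + w - v * w, fun x hx => ?_⟩
    rw [mul_sub, mul_add, ← mul_assoc]
    rcases Finset.mem_insert.1 hx with rfl | hx
    · rw [sub_mul] at hw
      rw [add_sub_assoc, hw]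
      abel
    · rw [hv x hx]
      abel

/-- In a ring with left units for elements, finite sets have common left units. -/
theorem exists_common_left_unit {R : Type*} [NonUnitalRing R] (h : ∀ x : R, ∃ u : R, u * x = x)
    (S : Finset R) : ∃ u : R, ∀ x ∈ S, u * x = x := by
  classical
  induction S using Finset.induction_on with
  | empty => exact ⟨0, by simp⟩
  | insert y S _ ih =>
    obtain ⟨v, hv⟩ := ih
    obtain ⟨w, hw⟩ := h (y - v * y)
    refine ⟨v + w - w * v, fun x hx => ?_⟩
    rw [sub_mul, add_mul, mul_assoc]
    rcases Finset.mem_insert.1 hx with rfl | hx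
    · rw [mul_sub] at hw
      rw [add_sub_assoc, hw]
      abel
    · rw [hv x hx]
      abel

/-! ### The ideal controlling proper infiniteness -/

/-- `a ⊕ x ≾ a`, in terms of matrix entries. -/
def AbsorbsSummand {R : Type*} [NonUnitalRing R] (a x : R) : Prop :=
  ∃ α₁ α₂ β₁ β₂ : R, α₁ * a * β₁ = a ∧ α₁ * a * β₂ = 0 ∧ α₂ * a * β₁ = 0 ∧ α₂ * a * β₂ = x

theorem isProperlyInfinite_of_absorbsSummand_self {R : Type*} [NonUnitalRing R] {a : R} (ha : a ≠ 0)
    (h : AbsorbsSummand a a) : IsProperlyInfinite a := by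
  obtain ⟨α₁, α₂, β₁, β₂, h₁₁, h₁₂, h₂₁, h₂₂⟩ := h
  refine ⟨ha, Matrix.of fun i _ => Sum.elim (fun _ => α₁) (fun _ => α₂) i,
    Matrix.of fun _ j => Sum.elim (fun _ => β₁) (fun _ => β₂) j, ?_⟩
  ext i j
  rcases i with i | i <;> rcases j with j | j <;>
    simp [blockSum, oneByOne, Matrix.mul_apply, h₁₁, h₁₂, h₂₁, h₂₂, Subsingleton.elim i j]

namespace AbsorbsSummand

variable {R : Type*} [NonUnitalRing R] {a x y : R}

theorem zero (h : IsSUnital R) : AbsorbsSummand a 0 := by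
  obtain ⟨u, v, hu, hv⟩ := h a
  exact ⟨u, 0, v, 0, by rw [hu, hv], by simp, by simp, by simp⟩

/-- From a ⊕ y ≾ a, replacing the summand a by a ⊕ x gives a ⊕ x ⊕ y ≾ a. Adding the last two rows
and columns of the multipliers turns x ⊕ y into x + y, because the off-diagonal entries vanish. -/
theorem add (hx : AbsorbsSummand a x) (hy : AbsorbsSummand a y) : AbsorbsSummand a (x + y) := by
  obtain ⟨α₁, α₂, β₁, β₂, h₁₁, h₁₂, h₂₁, h₂₂⟩ := hx
  obtain ⟨γ₁, γ₂, δ₁, δ₂, k₁₁, k₁₂, k₂₁, k₂₂⟩ := hy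
  have k₁₁' (q : R) : γ₁ * (a * (δ₁ * q)) = a * q := by
    rw [← mul_assoc, ← mul_assoc, k₁₁]
  have k₂₁' (q : R) : γ₂ * (a * (δ₁ * q)) = 0 := by
    rw [← mul_assoc, ← mul_assoc, k₂₁, zero_mul]
  rw [mul_assoc] at h₁₁ h₁₂ h₂₁ h₂₂ k₁₂ k₂₂
  exact ⟨α₁ * γ₁, α₂ * γ₁ + γ₂, δ₁ * β₁, δ₁ * β₂ + δ₂,
    by simp only [mul_assoc, k₁₁', h₁₁],
    by simp only [mul_assoc, mul_add, k₁₁', h₁₂, k₁₂, mul_zero, add_zero],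
    by simp only [mul_assoc, add_mul, k₁₁', k₂₁', h₂₁, add_zero],
    by simp only [mul_assoc, mul_add, add_mul, k₁₁', k₂₁', h₂₂, k₁₂, k₂₂, mul_zero, add_zero,
      zero_add]⟩

theorem neg (hx : AbsorbsSummand a x) : AbsorbsSummand a (-x) := by
  obtain ⟨α₁, α₂, β₁, β₂, h₁₁, h₁₂, h₂₁, h₂₂⟩ := hx
  exact ⟨α₁, -α₂, β₁, β₂, h₁₁, h₁₂, by simp [h₂₁], by simp [h₂₂]⟩

theorem mul_left (y : R) (hx : AbsorbsSummand a x) : AbsorbsSummand a (y * x) := by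
  obtain ⟨α₁, α₂, β₁, β₂, h₁₁, h₁₂, h₂₁, h₂₂⟩ := hx
  rw [mul_assoc] at h₂₁ h₂₂
  exact ⟨α₁, y * α₂, β₁, β₂, h₁₁, h₁₂, by simp [mul_assoc, h₂₁], by simp [mul_assoc, h₂₂]⟩

theorem mul_right (y : R) (hx : AbsorbsSummand a x) : AbsorbsSummand a (x * y) := by
  obtain ⟨α₁, α₂, β₁, β₂, h₁₁, h₁₂, h₂₁, h₂₂⟩ := hx
  exact ⟨α₁, α₂, β₁, β₂ * y, h₁₁, by simp [← mul_assoc, h₁₂], h₂₁, by simp [← mul_assoc, h₂₂]⟩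

end AbsorbsSummand

/-- The ideal of all `x` with `a ⊕ x ≾ a`. -/
def absorbedIdeal {R : Type*} [NonUnitalRing R] (h : IsSUnital R) (a : R) : TwoSidedIdeal R :=
  TwoSidedIdeal.mk' {x | AbsorbsSummand a x} (AbsorbsSummand.zero h) AbsorbsSummand.add AbsorbsSummand.neg
    (AbsorbsSummand.mul_left _) (AbsorbsSummand.mul_right _)

theorem mem_absorbedIdeal {R : Type*} [NonUnitalRing R] (h : IsSUnital R) {a x : R} :
    x ∈ absorbedIdeal h a ↔ AbsorbsSummand a x := by
  rw [absorbedIdeal, TwoSidedIdeal.mem_mk']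
  rfl

/-- A matrix `(αᵢ a βⱼ)` may be perturbed by elements that `a` absorbs. -/
theorem AbsorbsSummand.perturb {R ι : Type*} [NonUnitalRing R] {a n : R} (hn : AbsorbsSummand a n)
    (α β P Q : ι → R) :
    ∃ α' β' : ι → R, ∀ i j, α' i * a * β' j = α i * a * β j + P i * n * Q j := by
  obtain ⟨γ₁, γ₂, δ₁, δ₂, k₁₁, k₁₂, k₂₁, k₂₂⟩ := hn
  -- The given data contain orthogonal copies of a and n inside a, so α, β act on the first copy and
  -- P, Q on the second.
  refine ⟨fun i => α i * γ₁ + P i * γ₂, fun j => δ₁ * β j + δ₂ * Q j, fun i j => ?_⟩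
  calc _ = α i * (γ₁ * a * δ₁) * β j + α i * (γ₁ * a * δ₂) * Q j + P i * (γ₂ * a * δ₁) * β j
        + P i * (γ₂ * a * δ₂) * Q j := by
        simp only [mul_add, add_mul, mul_assoc]
        abel
    _ = _ := by simp [k₁₁, k₁₂, k₂₁, k₂₂]

/-- A congruence `a ⊕ x ≾ a` modulo absorbed elements is a genuine one. -/
theorem AbsorbsSummand.of_congruence {R : Type*} [NonUnitalRing R] (h : IsSUnital R)
    {a x α₁ α₂ β₁ β₂ : R} (h₁₁ : AbsorbsSummand a (α₁ * a * β₁ - a)) (h₁₂ : AbsorbsSummand a (α₁ * a * β₂))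
    (h₂₁ : AbsorbsSummand a (α₂ * a * β₁)) (h₂₂ : AbsorbsSummand a (α₂ * a * β₂ - x)) : AbsorbsSummand a x := by
  -- An absorbed n can be subtracted from a single entry (p, q) without touching the other three,
  -- since n = u n v. The four errors are removed one after another.
  have key (n : R) (hn : AbsorbsSummand a n) (p q : Fin 2) (α β : Fin 2 → R) :
      ∃ α' β' : Fin 2 → R, ∀ i j, α' i * a * β' j =
        α i * a * β j - if i = p then if j = q then n else 0 else 0 := by
    obtain ⟨u, v, hu, hv⟩ := h n
    obtain ⟨α', β', h'⟩ := hn.perturb α β (fun i => if i = p then -u else 0)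
      (fun j => if j = q then v else 0)
    refine ⟨α', β', fun i j => ?_⟩
    rw [h']
    split_ifs <;> simp [hu, hv, sub_eq_add_neg]
  obtain ⟨α, β, e₁⟩ := key _ h₁₁ 0 0 ![α₁, α₂] ![β₁, β₂]
  obtain ⟨α, β, e₂⟩ := key _ h₁₂ 0 1 α β
  obtain ⟨α, β, e₃⟩ := key _ h₂₁ 1 0 α β
  obtain ⟨α, β, e₄⟩ := key _ h₂₂ 1 1 α β
  refine ⟨α 0, α 1, β 0, β 1, ?_, ?_, ?_, ?_⟩ <;> rw [e₄, e₃, e₂, e₁] <;> simp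

/-- If `y a z` is a properly infinite idempotent `e`, then `a ⊕ e ≾ a`. -/
theorem absorbsSummand_of_properlyInfinite_idempotent {R : Type*} [NonUnitalRing R]
    {a y z e s₁ s₂ t₁ t₂ u v : R} (hu : u * a = a) (hv : a * v = a) (he : y * a * z = e)
    (hee : e * e = e) (hs₁ : e * s₁ = s₁) (hs₂ : e * s₂ = s₂) (ht₁ : t₁ * e = t₁)
    (ht₂ : t₂ * e = t₂) (h₁₁ : t₁ * s₁ = e) (h₁₂ : t₁ * s₂ = 0) (h₂₁ : t₂ * s₁ = 0)
    (h₂₂ : t₂ * s₂ = e) : AbsorbsSummand a e := by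
  have left {p q r : R} (h : p * q = r) (x : R) : p * (q * x) = r * x := by rw [← mul_assoc, h]
  have he' (x : R) : y * (a * (z * x)) = e * x := by rw [← he]; simp only [mul_assoc]
  -- Since y a z = e, the element a splits into a - a z e y a and a z e y a, and these are
  -- orthogonal for the multipliers used. The first part is kept, the second is reproduced through
  -- the pair s₁, t₁, and this leaves the pair s₂, t₂ free to produce e.
  refine ⟨u - a * z * e * y * u + a * z * t₁ * y, t₂ * y,
    v - z * e * y * a + z * s₁ * y * a, z * s₂, ?_, ?_, ?_, ?_⟩ <;>
  · simp only [mul_add, add_mul, mul_sub, sub_mul, mul_assoc, he', left hee, left hs₁, hs₂, left ht₁,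
      left ht₂, left h₁₁, h₁₂, left h₂₁, h₂₂, hu, hv, mul_zero, zero_mul]
    try abel

/-- A criterion for an s-unital ring to be properly purely infinite: modulo every ideal, every
nonzero element is compressed to a nonzero properly infinite idempotent. -/
theorem isProperlyPurelyInfinite_of_idempotents {R : Type*} [NonUnitalRing R] (h : IsSUnital R)
    (H : ∀ (N : TwoSidedIdeal R) (a : R), a ∉ N → ∃ y z e s₁ s₂ t₁ t₂ : N.ringCon.Quotient,
      e ≠ 0 ∧ y * a * z = e ∧ e * e = e ∧ e * s₁ = s₁ ∧ e * s₂ = s₂ ∧ t₁ * e = t₁ ∧ t₂ * e = t₂ ∧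
      t₁ * s₁ = e ∧ t₁ * s₂ = 0 ∧ t₂ * s₁ = 0 ∧ t₂ * s₂ = e) :
    IsProperlyPurelyInfinite R := by
  intro a ha
  refine isProperlyInfinite_of_absorbsSummand_self ha ?_
  by_contra hN
  set N := absorbedIdeal h a
  obtain ⟨y, z, e, s₁, s₂, t₁, t₂, he₀, he, hee, hs₁, hs₂, ht₁, ht₂, h₁₁, h₁₂, h₂₁, h₂₂⟩ :=
    H N a (by rwa [mem_absorbedIdeal])
  obtain ⟨u, v, hu, hv⟩ := h a
  obtain ⟨α₁, α₂, β₁, β₂, k₁₁, k₁₂, k₂₁, k₂₂⟩ := absorbsSummand_of_properlyInfinite_idempotent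
    (u := (u : N.ringCon.Quotient)) (v := (v : N.ringCon.Quotient))
    (by rw [← RingCon.coe_mul, hu]) (by rw [← RingCon.coe_mul, hv])
    he hee hs₁ hs₂ ht₁ ht₂ h₁₁ h₁₂ h₂₁ h₂₂
  induction e using Quotient.inductionOn' with | _ e
  induction α₁ using Quotient.inductionOn' with | _ α₁
  induction α₂ using Quotient.inductionOn' with | _ α₂
  induction β₁ using Quotient.inductionOn' with | _ β₁
  induction β₂ using Quotient.inductionOn' with | _ β₂
  -- The relations of a ⊕ e ≾ a hold modulo N, whose elements are exactly those absorbed by a, so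
  -- `of_congruence` puts e itself in N.
  refine he₀ ((N.coe_eq_zero_iff e).2 ((mem_absorbedIdeal h).2 ?_))
  exact AbsorbsSummand.of_congruence h ((mem_absorbedIdeal h).1 ((N.coe_eq_coe_iff _ _).1 k₁₁))
    ((mem_absorbedIdeal h).1 ((N.coe_eq_zero_iff _).1 k₁₂))
    ((mem_absorbedIdeal h).1 ((N.coe_eq_zero_iff _).1 k₂₁))
    ((mem_absorbedIdeal h).1 ((N.coe_eq_coe_iff _ _).1 k₂₂))

/-! ### Paths in Leavitt path algebras -/

theorem DirectedGraph.IsPath.append {V W : Type*} {E : DirectedGraph V W} {v w x : V} {p q : List W}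
    (hp : E.IsPath v p w) (hq : E.IsPath w q x) : E.IsPath v (p ++ q) x := by
  induction p generalizing v with
  | nil => cases hp; exact hq
  | cons e p ih => exact ⟨hp.1, ih hp.2⟩

theorem DirectedGraph.isPath_append {V W : Type*} {E : DirectedGraph V W} {v x : V} {p q : List W}
    (h : E.IsPath v (p ++ q) x) : ∃ w, E.IsPath v p w ∧ E.IsPath w q x := by
  induction p generalizing v with
  | nil => exact ⟨v, rfl, h⟩
  | cons e p ih =>
    obtain ⟨w, h₁, h₂⟩ := ih h.2
    exact ⟨w, ⟨h.1, h₁⟩, h₂⟩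

namespace LeavittPathAlgebra

variable (K : Type*) [Field K] {V W : Type*} (E : DirectedGraph V W)

/-- A vertex as an element of the Leavitt path algebra. -/
noncomputable def vertex (v : V) : LeavittPathAlgebra K E := mk K E (FreeLeavitt.vertex K v)

/-- An edge as an element of the Leavitt path algebra. -/
noncomputable def edge (e : W) : LeavittPathAlgebra K E := mk K E (FreeLeavitt.edge K e)

/-- A ghost edge as an element of the Leavitt path algebra. -/
noncomputable def ghost (e : W) : LeavittPathAlgebra K E := mk K E (FreeLeavitt.ghost K e)

variable {K E}

theorem mk_eq_of_rel {a b : FreeLeavitt K V W} (h : LeavittRel K E a b) : mk K E a = mk K E b := by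
  refine ((leavittIdeal K E).coe_eq_coe_iff a b).2 ?_
  rw [leavittIdeal, TwoSidedIdeal.mem_sInf]
  exact fun I hI => hI.2 a b h

theorem vertex_mul_self (v : V) : vertex K E v * vertex K E v = vertex K E v :=
  mk_eq_of_rel (.vertex_mul_self v)

theorem vertex_mul_ne {v w : V} (h : v ≠ w) : vertex K E v * vertex K E w = 0 :=
  mk_eq_of_rel (.vertex_mul_ne v w h)

theorem source_mul_edge (e : W) : vertex K E (E.s e) * edge K E e = edge K E e :=
  mk_eq_of_rel (.source_mul_edge e)

theorem edge_mul_range (e : W) : edge K E e * vertex K E (E.r e) = edge K E e :=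
  mk_eq_of_rel (.edge_mul_range e)

theorem range_mul_ghost (e : W) : vertex K E (E.r e) * ghost K E e = ghost K E e :=
  mk_eq_of_rel (.range_mul_ghost e)

theorem ghost_mul_source (e : W) : ghost K E e * vertex K E (E.s e) = ghost K E e :=
  mk_eq_of_rel (.ghost_mul_source e)

theorem ghost_mul_self (e : W) : ghost K E e * edge K E e = vertex K E (E.r e) :=
  mk_eq_of_rel (.ghost_mul_self e)

theorem ghost_mul_ne {e f : W} (h : e ≠ f) : ghost K E e * edge K E f = 0 :=
  mk_eq_of_rel (.ghost_mul_ne e f h)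

theorem vertex_eq_sum (hE : E.RowFinite) {v : V} (hne : ∃ e, E.s e = v) :
    vertex K E v = ∑ e ∈ (hE v).toFinset, edge K E e * ghost K E e := by
  have := mk_eq_of_rel (LeavittRel.vertex_eq_sum (K := K) v hne (hE v))
  rw [map_sum] at this
  exact this

/-- The Leavitt path algebra is generated by vertices, edges and ghost edges. -/
theorem induction_generators {p : LeavittPathAlgebra K E → Prop} (zero : p 0)
    (add : ∀ x y, p x → p y → p (x + y)) (smul : ∀ (k : K) x, p x → p (k • x))
    (mul : ∀ x y, p x → p y → p (x * y)) (vertex : ∀ v, p (vertex K E v))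
    (edge : ∀ e, p (edge K E e)) (ghost : ∀ e, p (ghost K E e)) (x : LeavittPathAlgebra K E) :
    p x := by
  obtain ⟨x, rfl⟩ := mk_surjective K E x
  induction x using MonoidAlgebra.induction_linear with
  | zero => rwa [map_zero]
  | add x y hx hy => rw [map_add]; exact add _ _ hx hy
  | single m k =>
    rw [← mul_one k, ← smul_eq_mul, ← MonoidAlgebra.smul_single, mk_smul]
    refine smul k _ ?_
    have gen (g : LeavittGenerator V W) :
        p (mk K E (MonoidAlgebra.single (FreeSemigroup.of g) 1)) := by
      cases g with
      | vertex v => exact vertex v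
      | edge e => exact edge e
      | ghost e => exact ghost e
    induction m using FreeSemigroup.recOnMul with
    | ih1 g => exact gen g
    | ih2 g m _ hm =>
      rw [← one_mul (1 : K), ← MonoidAlgebra.single_mul_single, mk_mul]
      exact mul _ _ (gen g) hm

theorem vertex_mul_edge_ne {v : V} {e : W} (h : E.s e ≠ v) : vertex K E v * edge K E e = 0 := by
  rw [← source_mul_edge, ← mul_assoc, vertex_mul_ne h.symm, zero_mul]

theorem ghost_mul_vertex_ne {v : V} {e : W} (h : E.s e ≠ v) : ghost K E e * vertex K E v = 0 := by
  rw [← ghost_mul_source, mul_assoc, vertex_mul_ne h, mul_zero]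

variable (K E)

/-- The element of the Leavitt path algebra given by a list of edges, to be traversed from `v`. It
is zero if the list is not a path. -/
noncomputable def path : V → List W → LeavittPathAlgebra K E
  | v, [] => vertex K E v
  | v, e :: p => vertex K E v * (edge K E e * path (E.r e) p)

/-- The ghost of a path. -/
noncomputable def ghostPath : V → List W → LeavittPathAlgebra K E
  | v, [] => vertex K E v
  | v, e :: p => ghostPath (E.r e) p * ghost K E e * vertex K E v

variable {K E}

theorem vertex_mul_path (v : V) (p : List W) : vertex K E v * path K E v p = path K E v p := by
  cases p <;> simp only [path, ← mul_assoc, vertex_mul_self]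

theorem vertex_mul_path_ne {u v : V} (h : u ≠ v) (p : List W) :
    vertex K E u * path K E v p = 0 := by
  rw [← vertex_mul_path, ← mul_assoc, vertex_mul_ne h, zero_mul]

theorem ghostPath_mul_vertex (v : V) (p : List W) :
    ghostPath K E v p * vertex K E v = ghostPath K E v p := by
  cases p <;> simp only [ghostPath, mul_assoc, vertex_mul_self]

theorem ghostPath_cons {v w : V} {e : W} {p : List W} (h : E.IsPath v (e :: p) w) :
    ghostPath K E v (e :: p) = ghostPath K E (E.r e) p * ghost K E e := by
  rw [ghostPath, mul_assoc, ← h.1, ghost_mul_source]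

theorem path_mul_vertex {v w : V} {p : List W} (h : E.IsPath v p w) :
    path K E v p * vertex K E w = path K E v p := by
  induction p generalizing v with
  | nil => cases h; exact vertex_mul_self _
  | cons e p ih => simp only [path, mul_assoc, ih h.2]

theorem path_eq_zero {v : V} {p : List W} (h : ¬ ∃ w, E.IsPath v p w) : path K E v p = 0 := by
  induction p generalizing v with
  | nil => exact absurd ⟨v, rfl⟩ h
  | cons e p ih =>
    by_cases hv : E.s e = v
    · rw [path, ih fun ⟨w, hw⟩ => h ⟨w, hv, hw⟩, mul_zero, mul_zero]
    · rw [path, ← mul_assoc, vertex_mul_edge_ne hv, zero_mul]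

theorem path_mul_path {v w : V} {p : List W} (h : E.IsPath v p w) (q : List W) :
    path K E v p * path K E w q = path K E v (p ++ q) := by
  induction p generalizing v with
  | nil => cases h; exact vertex_mul_path _ q
  | cons e p ih => simp only [path, List.cons_append, mul_assoc, ih h.2]

theorem path_mul_path_ne {u v w : V} {p : List W} (h : E.IsPath v p w) (hw : w ≠ u) (q : List W) :
    path K E v p * path K E u q = 0 := by
  rw [← path_mul_vertex h, mul_assoc, vertex_mul_path_ne hw, mul_zero]

theorem ghostPath_mul_path_append {v w : V} {p : List W} (h : E.IsPath v p w) (q : List W) :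
    ghostPath K E v p * path K E v (p ++ q) = path K E w q := by
  induction p generalizing v with
  | nil => cases h; exact vertex_mul_path _ q
  | cons e p ih =>
    rw [ghostPath_cons h, List.cons_append, path, ← h.1, ← mul_assoc (vertex K E _), source_mul_edge,
      mul_assoc, ← mul_assoc (ghost K E e), ghost_mul_self, vertex_mul_path, ih h.2]

theorem ghostPath_mul_path_self {v w : V} {p : List W} (h : E.IsPath v p w) :
    ghostPath K E v p * path K E v p = vertex K E w := by
  simpa [path] using ghostPath_mul_path_append (K := K) h []

/-- Common initial edges cancel by e* e = r(e). Incomparable lists must differ somewhere, and there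
e* f = 0. A list that fails to be a path before that point already gives zero. -/
theorem ghostPath_mul_path_eq_zero {v : V} {p q : List W} (h : ¬ p <+: q)
    (h' : ¬ q <+: p) : ghostPath K E v p * path K E v q = 0 := by
  induction p generalizing v q with
  | nil => exact absurd (List.nil_prefix) h
  | cons e p ih =>
    cases q with
    | nil => exact absurd (List.nil_prefix) h'
    | cons f q =>
      by_cases hv : E.s f = v
      · rw [path, ← mul_assoc (vertex K E v), ← hv, source_mul_edge, ghostPath]
        by_cases hef : e = f
        · subst hef
          rw [mul_assoc _ (ghost K E e), ghost_mul_source, mul_assoc, ← mul_assoc (ghost K E e),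
            ghost_mul_self, vertex_mul_path]
          exact ih (fun hp => h (List.cons_prefix_cons.2 ⟨rfl, hp⟩))
            fun hp => h' (List.cons_prefix_cons.2 ⟨rfl, hp⟩)
        · rw [mul_assoc, mul_assoc, ← mul_assoc (vertex K E _), source_mul_edge,
            ← mul_assoc (ghost K E e), ghost_mul_ne hef, zero_mul, mul_zero]
      · rw [path, ← mul_assoc (vertex K E v), vertex_mul_edge_ne hv, zero_mul, mul_zero]

/-! ### Local units and polynomial multiples -/

-- Allowing every larger `F` lets the supports of two summands be merged in the induction.
open Classical in
theorem exists_vertices_mul_right (x : LeavittPathAlgebra K E) :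
    ∃ F₀ : Finset V, ∀ F, F₀ ⊆ F → x * ∑ v ∈ F, vertex K E v = x := by
  have single (x : LeavittPathAlgebra K E) (w : V) (hx : x * vertex K E w = x) :
      ∃ F₀ : Finset V, ∀ F, F₀ ⊆ F → x * ∑ v ∈ F, vertex K E v = x := by
    refine ⟨{w}, fun F hF => ?_⟩
    rw [← hx, mul_assoc, Finset.mul_sum, Finset.sum_eq_single_of_mem w (by simpa using hF)
      fun v _ hv => vertex_mul_ne hv.symm, vertex_mul_self]
  induction x using induction_generators with
  | zero => exact ⟨∅, fun F _ => zero_mul _⟩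
  | add x y hx hy =>
    obtain ⟨F₁, h₁⟩ := hx
    obtain ⟨F₂, h₂⟩ := hy
    exact ⟨F₁ ∪ F₂, fun F hF => by
      rw [add_mul, h₁ F (Finset.union_subset_left hF), h₂ F (Finset.union_subset_right hF)]⟩
  | smul k x hx =>
    obtain ⟨F₁, h₁⟩ := hx
    exact ⟨F₁, fun F hF => by rw [smul_mul_assoc, h₁ F hF]⟩
  | mul x y _ hy =>
    obtain ⟨F₁, h₁⟩ := hy
    exact ⟨F₁, fun F hF => by rw [mul_assoc, h₁ F hF]⟩
  | vertex v => exact single _ v (vertex_mul_self v)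
  | edge e => exact single _ _ (edge_mul_range e)
  | ghost e => exact single _ _ (ghost_mul_source e)

open Classical in
theorem exists_vertices_mul_left (x : LeavittPathAlgebra K E) :
    ∃ F₀ : Finset V, ∀ F, F₀ ⊆ F → (∑ v ∈ F, vertex K E v) * x = x := by
  have single (x : LeavittPathAlgebra K E) (w : V) (hx : vertex K E w * x = x) :
      ∃ F₀ : Finset V, ∀ F, F₀ ⊆ F → (∑ v ∈ F, vertex K E v) * x = x := by
    refine ⟨{w}, fun F hF => ?_⟩
    rw [← hx, ← mul_assoc, Finset.sum_mul, Finset.sum_eq_single_of_mem w (by simpa using hF)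
      fun v _ hv => vertex_mul_ne hv, vertex_mul_self]
  induction x using induction_generators with
  | zero => exact ⟨∅, fun F _ => mul_zero _⟩
  | add x y hx hy =>
    obtain ⟨F₁, h₁⟩ := hx
    obtain ⟨F₂, h₂⟩ := hy
    exact ⟨F₁ ∪ F₂, fun F hF => by
      rw [mul_add, h₁ F (Finset.union_subset_left hF), h₂ F (Finset.union_subset_right hF)]⟩
  | smul k x hx =>
    obtain ⟨F₁, h₁⟩ := hx
    exact ⟨F₁, fun F hF => by rw [mul_smul_comm, h₁ F hF]⟩
  | mul x y hx _ =>
    obtain ⟨F₁, h₁⟩ := hx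
    exact ⟨F₁, fun F hF => by rw [← mul_assoc, h₁ F hF]⟩
  | vertex v => exact single _ v (vertex_mul_self v)
  | edge e => exact single _ _ (source_mul_edge e)
  | ghost e => exact single _ _ (range_mul_ghost e)

variable (K E) in
/-- The span of the real paths. -/
noncomputable def pathSpan : Submodule K (LeavittPathAlgebra K E) :=
  Submodule.span K (Set.range fun x : V × List W => path K E x.1 x.2)

theorem path_mem_pathSpan (v : V) (p : List W) : path K E v p ∈ pathSpan K E :=
  Submodule.subset_span ⟨(v, p), rfl⟩

/-- Multiplication by a long path on the right removes the ghost edges. -/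
theorem exists_mul_path_mem_pathSpan (x : LeavittPathAlgebra K E) :
    ∃ n, ∀ v β, n ≤ β.length → x * path K E v β ∈ pathSpan K E := by
  induction x using induction_generators with
  | zero => exact ⟨0, fun v β _ => by rw [zero_mul]; exact zero_mem _⟩
  | add x y hx hy =>
    obtain ⟨n, hn⟩ := hx
    obtain ⟨m, hm⟩ := hy
    exact ⟨max n m, fun v β h => by
      rw [add_mul]
      exact add_mem (hn v β (le_of_max_le_left h)) (hm v β (le_of_max_le_right h))⟩
  | smul k x hx =>
    obtain ⟨n, hn⟩ := hx
    exact ⟨n, fun v β h => by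
      rw [smul_mul_assoc]
      exact Submodule.smul_mem _ _ (hn v β h)⟩
  | mul x y hx hy =>
    obtain ⟨n, hn⟩ := hx
    obtain ⟨m, hm⟩ := hy
    -- The first m edges of β clear the ghosts of y and leave a combination of real paths. Each of
    -- these either annihilates the rest of β or is prolonged by it, and the rest is still long
    -- enough for x.
    refine ⟨m + n, fun v β h => ?_⟩
    by_cases hβ : ∃ w, E.IsPath v β w
    · obtain ⟨w, hw⟩ := hβ
      rw [← List.take_append_drop m β] at hw
      obtain ⟨u, h₁, h₂⟩ := DirectedGraph.isPath_append hw
      rw [← List.take_append_drop m β, ← path_mul_path h₁, mul_assoc, ← mul_assoc y]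
      have hy := hm v (β.take m) (by rw [List.length_take]; omega)
      generalize y * path K E v (β.take m) = z at hy
      have hd : n ≤ (β.drop m).length := by rw [List.length_drop]; omega
      generalize β.drop m = γ at hd
      induction hy using Submodule.span_induction with
      | mem _ hz =>
        obtain ⟨⟨a, q⟩, rfl⟩ := hz
        by_cases hq : ∃ b, E.IsPath a q b
        · obtain ⟨b, hb⟩ := hq
          by_cases hbu : b = u
          · subst hbu
            simp only [path_mul_path hb]
            exact hn a _ (by rw [List.length_append]; omega)
          · simp only [path_mul_path_ne hb hbu, mul_zero, zero_mem]
        · simp only [path_eq_zero hq, zero_mul, mul_zero, zero_mem]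
      | zero => simp only [zero_mul, mul_zero, zero_mem]
      | add a b _ _ ha hb =>
        rw [add_mul, mul_add]
        exact add_mem ha hb
      | smul k a _ ha =>
        rw [smul_mul_assoc, mul_smul_comm]
        exact Submodule.smul_mem _ _ ha
    · simp only [path_eq_zero hβ, mul_zero, zero_mem]
  | vertex v =>
    refine ⟨0, fun w β _ => ?_⟩
    by_cases h : v = w
    · rw [h, vertex_mul_path]
      exact path_mem_pathSpan _ _
    · rw [vertex_mul_path_ne h]
      exact zero_mem _
  | edge e =>
    refine ⟨0, fun w β _ => ?_⟩
    by_cases h : E.r e = w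
    · subst h
      have : path K E (E.s e) (e :: β) = edge K E e * path K E (E.r e) β := by
        rw [path, ← mul_assoc, source_mul_edge]
      rw [← this]
      exact path_mem_pathSpan _ _
    · rw [← edge_mul_range, mul_assoc, vertex_mul_path_ne h, mul_zero]
      exact zero_mem _
  | ghost e =>
    refine ⟨1, fun w β h => ?_⟩
    cases β with
    | nil => simp at h
    | cons f β =>
      by_cases hw : E.s e = w
      · subst hw
        rw [path, ← mul_assoc, ghost_mul_source, ← mul_assoc]
        by_cases hef : e = f
        · subst hef
          rw [ghost_mul_self, vertex_mul_path]
          exact path_mem_pathSpan _ _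
        · rw [ghost_mul_ne hef, zero_mul]
          exact zero_mem _
      · rw [path, ← mul_assoc, ghost_mul_vertex_ne hw, zero_mul]
        exact zero_mem _

end LeavittPathAlgebra

/-! ### Graphs -/

/-- A list τ that is a prefix of γ ++ τ is a prefix of the periodic word γγγ…, hence determined by
its length. -/
theorem List.eq_of_prefix_append_self {α : Type*} {γ : List α} (hγ : γ ≠ []) {τ τ' : List α}
    (hl : τ.length = τ'.length) (h : τ <+: γ ++ τ) (h' : τ' <+: γ ++ τ') : τ = τ' := by
  induction hn : τ.length using Nat.strong_induction_on generalizing τ τ' with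
  | _ n ih =>
    have hpos := List.length_pos_iff.2 hγ
    rcases le_total τ.length γ.length with hle | hle
    · have h₁ := List.prefix_of_prefix_length_le h (List.prefix_append _ _) hle
      have h₂ := List.prefix_of_prefix_length_le h' (List.prefix_append _ _) (hl ▸ hle)
      exact (List.prefix_of_prefix_length_le h₁ h₂ hl.le).eq_of_length hl
    · obtain ⟨σ, rfl⟩ := List.prefix_of_prefix_length_le (List.prefix_append γ τ) h hle
      obtain ⟨σ', rfl⟩ := List.prefix_of_prefix_length_le (List.prefix_append γ τ') h' (hl ▸ hle)
      rw [List.prefix_append_right_inj] at h h'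
      simp only [List.length_append] at hl hn
      rw [ih σ.length (by omega) (by omega) h h' rfl]

namespace DirectedGraph

variable {V W : Type*} {E : DirectedGraph V W}

/-- If the only hereditary saturated sets are trivial, every vertex connects to every cycle. -/
theorem connects_cycle (h_simple : ∀ H : Set V, E.IsHereditary H → E.IsSaturated H →
      H = ∅ ∨ H = Set.univ) {c : List W} (hc : E.IsCycle c) {f : W} (hf : f ∈ c) (v : V) :
    E.Connects v (E.s f) := by
  have hret : E.Connects (E.r f) (E.s f) := by
    obtain ⟨-, ⟨w, hw⟩, -⟩ := hc
    obtain ⟨p, q, rfl⟩ := List.append_of_mem hf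
    obtain ⟨x, hp, hx, hq⟩ := isPath_append hw
    subst hx
    exact ⟨q ++ p, hq.append hp⟩
  -- The vertices that do not reach s(f) form a hereditary set that misses s(f). It is saturated
  -- because the first edge of a path to s(f) ends outside the set. For the trivial path f itself
  -- serves as this edge, which uses `hret`.
  have H := h_simple {u | ¬ E.Connects u (E.s f)} ?_ ?_
  · rcases H with h | h
    · by_contra hv
      exact (Set.ext_iff.1 h v).1 hv
    · exact absurd ⟨[], rfl⟩ ((Set.ext_iff.1 h (E.s f)).2 trivial)
  · rintro u w ⟨p, hp⟩ hu ⟨q, hq⟩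
    exact hu ⟨p ++ q, hp.append hq⟩
  · rintro u - hu ⟨p, hp⟩
    cases p with
    | nil => exact hu f hp.symm hret
    | cons e p => exact hu e hp.1 ⟨p, hp.2⟩

/-- There are no sinks, so the relation v = ∑ e e* is available at every vertex. -/
theorem exists_emits (h_cycle : ∀ v : V, E.ConnectsToCycle v) (v : V) : ∃ e, E.s e = v := by
  obtain ⟨-, -, f, -, p, hp⟩ := h_cycle v
  cases p with
  | nil => exact ⟨f, hp.symm⟩
  | cons e p => exact ⟨e, hp.1⟩

/-- A vertex to which all vertices connect, and which emits two distinct edges. -/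
structure IsBranchingHub (E : DirectedGraph V W) (w : V) : Prop where
  connects : ∀ v, E.Connects v w
  branches : ∃ e f, E.s e = w ∧ E.s f = w ∧ e ≠ f

/-- The hub is a vertex at which a cycle has an exit: the cycle edge and the exit are the two
branches. -/
theorem exists_isBranchingHub [Nonempty V]
    (h_simple : ∀ H : Set V, E.IsHereditary H → E.IsSaturated H → H = ∅ ∨ H = Set.univ)
    (h_exit : ∀ p : List W, E.IsCycle p → ∃ e, E.IsExit e p)
    (h_cycle : ∀ v : V, E.ConnectsToCycle v) : ∃ w, E.IsBranchingHub w := by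
  obtain ⟨c, hc, -⟩ := h_cycle (Classical.arbitrary V)
  obtain ⟨e, f, hf, hs, hne⟩ := h_exit c hc
  exact ⟨E.s f, connects_cycle h_simple hc hf, e, f, hs, rfl, hne⟩

namespace IsBranchingHub

variable {w : V}

/-- Leave the hub by two different edges and return. The two resulting paths provide the orthogonal
pair behind proper infiniteness. -/
theorem exists_closed_paths (hw : E.IsBranchingHub w) : ∃ σ₁ σ₂ : List W, E.IsPath w σ₁ w ∧ E.IsPath w σ₂ w ∧
    ¬ σ₁ <+: σ₂ ∧ ¬ σ₂ <+: σ₁ := by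
  obtain ⟨e, f, he, hf, hne⟩ := hw.branches
  obtain ⟨p, hp⟩ := hw.connects (E.r e)
  obtain ⟨q, hq⟩ := hw.connects (E.r f)
  refine ⟨e :: p, f :: q, ⟨he, hp⟩, ⟨hf, hq⟩, ?_, ?_⟩
  · rw [List.cons_prefix_cons]
    exact fun h => hne h.1
  · rw [List.cons_prefix_cons]
    exact fun h => hne h.1.symm

/-- Going to the hub and leaving by either branch gives two distinct paths of equal length. By
`List.eq_of_prefix_append_self` they cannot both be prefixes of their own shifts by γ. -/
theorem exists_path_not_prefix (hw : E.IsBranchingHub w) (v : V) {γ : List W} (hγ : γ ≠ []) :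
    ∃ τ x, E.IsPath v τ x ∧ ¬ τ <+: γ ++ τ := by
  obtain ⟨e, f, he, hf, hne⟩ := hw.branches
  obtain ⟨p, hp⟩ := hw.connects v
  by_contra! H
  have := List.eq_of_prefix_append_self hγ (by simp) (H (p ++ [e]) _ (hp.append ⟨he, rfl⟩))
    (H (p ++ [f]) _ (hp.append ⟨hf, rfl⟩))
  exact hne (by simpa using this)

end IsBranchingHub

end DirectedGraph

/-! ### Polynomials in real paths -/

namespace LeavittPathAlgebra

variable {K : Type*} [Field K] {A : Type*} [NonUnitalRing A] [Module K A]
  {V W : Type*} {E : DirectedGraph V W}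

variable (K E) in
/-- A linear combination of paths from `v` with coefficients in `A`. -/
noncomputable def pathPoly (v : V) (l : List (A × List W)) : A ⊗[K] LeavittPathAlgebra K E :=
  (l.map fun t => t.1 ⊗ₜ[K] path K E v t.2).sum

theorem pathPoly_cons (v : V) (t : A × List W) (l : List (A × List W)) :
    pathPoly K E v (t :: l) = t.1 ⊗ₜ[K] path K E v t.2 + pathPoly K E v l := by
  simp [pathPoly]

theorem pathPoly_append (v : V) (l l' : List (A × List W)) :
    pathPoly K E v (l ++ l') = pathPoly K E v l + pathPoly K E v l' := by
  simp [pathPoly]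

/-- Separation of the constant term. -/
theorem exists_pathPoly_eq_add (v : V) {n : ℕ} (l : List (A × List W))
    (hl : ∀ t ∈ l, t.2.length ≤ n) : ∃ (b : A) (l' : List (A × List W)),
      pathPoly K E v l = b ⊗ₜ[K] vertex K E v + pathPoly K E v l' ∧
      ∀ t ∈ l', t.2 ≠ [] ∧ t.2.length ≤ n := by
  induction l with
  | nil => exact ⟨0, [], by simp, by simp⟩
  | cons t l ih =>
    obtain ⟨b, l', h, h'⟩ := ih fun t ht => hl t (List.mem_cons_of_mem _ ht)
    by_cases ht : t.2 = []
    · refine ⟨t.1 + b, l', ?_, h'⟩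
      rw [pathPoly_cons, h, ht, path, TensorProduct.add_tmul, add_assoc]
    · refine ⟨b, t :: l', ?_, ?_⟩
      · rw [pathPoly_cons, pathPoly_cons, h]
        abel
      · intro s hs
        rcases List.mem_cons.1 hs with rfl | hs
        · exact ⟨ht, hl _ (by simp)⟩
        · exact h' s hs

end LeavittPathAlgebra

/-! ### Tensor products with Leavitt path algebras -/

namespace LeavittPathAlgebra

variable {K : Type*} [Field K]
  {A : Type*} [NonUnitalRing A] [Module K A] [IsScalarTower K A A] [SMulCommClass K A A]
  {V W : Type*} {E : DirectedGraph V W}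

theorem tmul_mul (a b : A) (x y : LeavittPathAlgebra K E) :
    (a ⊗ₜ[K] x) * (b ⊗ₜ[K] y) = (a * b) ⊗ₜ[K] (x * y) :=
  Algebra.TensorProduct.tmul_mul_tmul a b x y

open Classical in
theorem exists_tensor_right_unit (hA : IsSUnital A) (x : A ⊗[K] LeavittPathAlgebra K E) :
    ∃ (u : A) (F : Finset V), x * (u ⊗ₜ[K] ∑ v ∈ F, vertex K E v) = x := by
  suffices h : ∃ (S : Finset A) (F₀ : Finset V), ∀ u : A, (∀ a ∈ S, a * u = a) →
      ∀ F, F₀ ⊆ F → x * (u ⊗ₜ[K] ∑ v ∈ F, vertex K E v) = x by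
    obtain ⟨S, F, h⟩ := h
    obtain ⟨u, hu⟩ := exists_common_right_unit (fun a => (hA a).elim fun _ ⟨v, h⟩ => ⟨v, h.2⟩) S
    exact ⟨u, F, h u hu F subset_rfl⟩
  induction x using TensorProduct.induction_on with
  | zero => exact ⟨∅, ∅, fun _ _ _ _ => zero_mul _⟩
  | tmul a x =>
    obtain ⟨F, hF⟩ := exists_vertices_mul_right x
    exact ⟨{a}, F, fun u hu F' hF' => by rw [tmul_mul, hu a (by simp), hF F' hF']⟩
  | add x y hx hy =>
    obtain ⟨S₁, F₁, h₁⟩ := hx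
    obtain ⟨S₂, F₂, h₂⟩ := hy
    refine ⟨S₁ ∪ S₂, F₁ ∪ F₂, fun u hu F hF => ?_⟩
    rw [add_mul, h₁ u (fun a ha => hu a (Finset.mem_union_left _ ha)) F
      (Finset.union_subset_left hF), h₂ u (fun a ha => hu a (Finset.mem_union_right _ ha)) F
      (Finset.union_subset_right hF)]

open Classical in
theorem exists_tensor_left_unit (hA : IsSUnital A) (x : A ⊗[K] LeavittPathAlgebra K E) :
    ∃ (u : A) (F : Finset V), (u ⊗ₜ[K] ∑ v ∈ F, vertex K E v) * x = x := by
  suffices h : ∃ (S : Finset A) (F₀ : Finset V), ∀ u : A, (∀ a ∈ S, u * a = a) →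
      ∀ F, F₀ ⊆ F → (u ⊗ₜ[K] ∑ v ∈ F, vertex K E v) * x = x by
    obtain ⟨S, F, h⟩ := h
    obtain ⟨u, hu⟩ := exists_common_left_unit (fun a => (hA a).imp fun _ ⟨_, h⟩ => h.1) S
    exact ⟨u, F, h u hu F subset_rfl⟩
  induction x using TensorProduct.induction_on with
  | zero => exact ⟨∅, ∅, fun _ _ _ _ => mul_zero _⟩
  | tmul a x =>
    obtain ⟨F, hF⟩ := exists_vertices_mul_left x
    exact ⟨{a}, F, fun u hu F' hF' => by rw [tmul_mul, hu a (by simp), hF F' hF']⟩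
  | add x y hx hy =>
    obtain ⟨S₁, F₁, h₁⟩ := hx
    obtain ⟨S₂, F₂, h₂⟩ := hy
    refine ⟨S₁ ∪ S₂, F₁ ∪ F₂, fun u hu F hF => ?_⟩
    rw [mul_add, h₁ u (fun a ha => hu a (Finset.mem_union_left _ ha)) F
      (Finset.union_subset_left hF), h₂ u (fun a ha => hu a (Finset.mem_union_right _ ha)) F
      (Finset.union_subset_right hF)]

theorem isSUnital_tensor (hA : IsSUnital A) : IsSUnital (A ⊗[K] LeavittPathAlgebra K E) := by
  intro x
  obtain ⟨u, F, hu⟩ := exists_tensor_left_unit hA x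
  obtain ⟨v, G, hv⟩ := exists_tensor_right_unit hA x
  exact ⟨_, _, hu, hv⟩

/-! ### Testing membership in an ideal of the tensor product on vertices and paths. -/

section Ideal

variable {N : TwoSidedIdeal (A ⊗[K] LeavittPathAlgebra K E)}

theorem mem_of_mul_vertex_mem (hA : IsSUnital A) {x : A ⊗[K] LeavittPathAlgebra K E}
    (h : ∀ (u : A) v, x * (u ⊗ₜ[K] vertex K E v) ∈ N) : x ∈ N := by
  obtain ⟨u, F, hu⟩ := exists_tensor_right_unit hA x
  rw [← hu, TensorProduct.tmul_sum, Finset.mul_sum]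
  exact sum_mem fun v _ => h u v

theorem mem_of_vertex_mul_mem (hA : IsSUnital A) {x : A ⊗[K] LeavittPathAlgebra K E}
    (h : ∀ (u : A) v, (u ⊗ₜ[K] vertex K E v) * x ∈ N) : x ∈ N := by
  obtain ⟨u, F, hu⟩ := exists_tensor_left_unit hA x
  rw [← hu, TensorProduct.tmul_sum, Finset.sum_mul]
  exact sum_mem fun v _ => h u v

/-- Expanding the range vertex w of a path as ∑ e e* lengthens the path by one edge.
Contrapositively, an element outside `N` stays outside after right multiplication by suitable paths
of any prescribed length. -/
theorem mem_of_mul_path_mem (hA : IsSUnital A) (hE : E.RowFinite) (hs : ∀ v, ∃ e, E.s e = v)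
    (n : ℕ) {x : A ⊗[K] LeavittPathAlgebra K E}
    (h : ∀ (u : A) v β, β.length = n → x * (u ⊗ₜ[K] path K E v β) ∈ N) : x ∈ N := by
  induction n with
  | zero => exact mem_of_mul_vertex_mem hA fun u v => h u v [] rfl
  | succ n ih =>
    refine ih fun u v β hβ => ?_
    by_cases hp : ∃ w, E.IsPath v β w
    · obtain ⟨w, hw⟩ := hp
      obtain ⟨-, u', -, hu'⟩ := hA u
      rw [← path_mul_vertex hw, vertex_eq_sum hE (hs w), Finset.mul_sum, TensorProduct.tmul_sum,
        Finset.mul_sum]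
      refine sum_mem fun e he => ?_
      have he : E.s e = w := by simpa using he
      have hedge : path K E w [e] = edge K E e := by
        rw [path, path, edge_mul_range, ← he, source_mul_edge]
      rw [← mul_assoc, ← hedge, path_mul_path hw, ← hu', ← tmul_mul, ← mul_assoc]
      exact N.mul_mem_right _ _ (h u v _ (by simp [hβ]))
    · rw [path_eq_zero hp, TensorProduct.tmul_zero, mul_zero]
      exact N.zero_mem

theorem vertex_mul_mem_of_ghost_mul_mem (hA : IsSUnital A) (hE : E.RowFinite) {v : V}
    (hv : ∃ e, E.s e = v) {x : A ⊗[K] LeavittPathAlgebra K E}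
    (h : ∀ (u : A) e, E.s e = v → (u ⊗ₜ[K] ghost K E e) * x ∈ N) (u : A) :
    (u ⊗ₜ[K] vertex K E v) * x ∈ N := by
  obtain ⟨u', -, hu', -⟩ := hA u
  rw [vertex_eq_sum hE hv, TensorProduct.tmul_sum, Finset.sum_mul]
  refine sum_mem fun e he => ?_
  rw [← hu', ← tmul_mul, mul_assoc]
  exact N.mul_mem_left _ _ (h u e (by simpa using he))

/-- Membership of `b ⊗ v` in an ideal does not depend on the vertex `v`. -/
theorem tmul_vertex_mem (hA : IsSUnital A) (hE : E.RowFinite)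
    (h_simple : ∀ H : Set V, E.IsHereditary H → E.IsSaturated H → H = ∅ ∨ H = Set.univ)
    {b : A} {v : V} (h : b ⊗ₜ[K] vertex K E v ∈ N) (w : V) : b ⊗ₜ[K] vertex K E w ∈ N := by
  obtain ⟨u, u', hu, hu'⟩ := hA b
  -- The set is hereditary because y = p* x p for a path p from x to y, and saturated because x = ∑
  -- e r(e) e*. It contains v, so it is everything.
  have H := h_simple {x | b ⊗ₜ[K] vertex K E x ∈ N} ?_ ?_
  · rcases H with H | H
    · exact absurd h (Set.ext_iff.1 H v).1
    · exact (Set.ext_iff.1 H w).2 trivial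
  · rintro x y ⟨p, hp⟩ hx
    have : b ⊗ₜ[K] vertex K E y =
        (u ⊗ₜ[K] ghostPath K E x p) * ((b ⊗ₜ[K] vertex K E x) * (u' ⊗ₜ[K] path K E x p)) := by
      rw [tmul_mul, tmul_mul, vertex_mul_path, ghostPath_mul_path_self hp, hu', hu]
    change _ ∈ N
    rw [this]
    exact N.mul_mem_left _ _ (N.mul_mem_right _ _ hx)
  · intro x hx hr
    change _ ∈ N
    rw [vertex_eq_sum hE hx, TensorProduct.tmul_sum]
    refine sum_mem fun e he => ?_
    have : b ⊗ₜ[K] (edge K E e * ghost K E e) =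
        (u ⊗ₜ[K] edge K E e) * ((b ⊗ₜ[K] vertex K E (E.r e)) * (u' ⊗ₜ[K] ghost K E e)) := by
      rw [tmul_mul, tmul_mul, range_mul_ghost, hu', hu]
    rw [this]
    exact N.mul_mem_left _ _ (N.mul_mem_right _ _ (hr e (by simpa using he)))

theorem tmul_mul_mem {b : A} (hA : IsSUnital A) {x : LeavittPathAlgebra K E} (h : b ⊗ₜ[K] x ∈ N)
    (y : LeavittPathAlgebra K E) : b ⊗ₜ[K] (x * y) ∈ N := by
  obtain ⟨-, v, -, hv⟩ := hA b
  rw [← hv, ← tmul_mul]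
  exact N.mul_mem_right _ _ h

theorem tmul_mul_mem_left {b : A} (hA : IsSUnital A) {x : LeavittPathAlgebra K E}
    (h : b ⊗ₜ[K] x ∈ N) (y : LeavittPathAlgebra K E) : b ⊗ₜ[K] (y * x) ∈ N := by
  obtain ⟨u, -, hu, -⟩ := hA b
  rw [← hu, ← tmul_mul]
  exact N.mul_mem_left _ _ h

end Ideal

/-! ### Compression of an element, modulo an ideal, to a coefficient at the hub. -/

theorem exists_vertex_mul_pathPoly (hA : IsSUnital A) (v : V) (l : List (A × List W)) :
    ∃ u : A, (u ⊗ₜ[K] vertex K E v) * pathPoly K E v l = pathPoly K E v l := by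
  classical
  obtain ⟨u, hu⟩ := exists_common_left_unit (fun a => (hA a).imp fun _ ⟨_, h⟩ => h.1)
    (l.map Prod.fst).toFinset
  refine ⟨u, ?_⟩
  induction l with
  | nil => simp [pathPoly]
  | cons t l ih =>
    rw [pathPoly_cons, mul_add, tmul_mul, vertex_mul_path, hu t.1 (by simp),
      ih fun x hx => hu x (by simp at hx ⊢; exact Or.inr hx)]

/-- A long path on the right removes the ghosts, and the vertex on the left selects the paths
starting there, so that one base vertex serves all terms. -/
theorem exists_mul_path_eq_pathPoly (x : A ⊗[K] LeavittPathAlgebra K E) :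
    ∃ n, ∀ (u : A) v β, n ≤ β.length → ∀ (u' : A) v', ∃ l,
      (u' ⊗ₜ[K] vertex K E v') * (x * (u ⊗ₜ[K] path K E v β)) = pathPoly K E v' l := by
  induction x using TensorProduct.induction_on with
  | zero => exact ⟨0, fun _ _ _ _ _ _ => ⟨[], by simp [pathPoly]⟩⟩
  | add x y hx hy =>
    obtain ⟨n, hn⟩ := hx
    obtain ⟨m, hm⟩ := hy
    refine ⟨max n m, fun u v β h u' v' => ?_⟩
    obtain ⟨l₁, h₁⟩ := hn u v β (le_of_max_le_left h) u' v'
    obtain ⟨l₂, h₂⟩ := hm u v β (le_of_max_le_right h) u' v'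
    exact ⟨l₁ ++ l₂, by rw [add_mul, mul_add, h₁, h₂, pathPoly_append]⟩
  | tmul a x =>
    obtain ⟨n, hn⟩ := exists_mul_path_mem_pathSpan x
    refine ⟨n, fun u v β h u' v' => ?_⟩
    rw [tmul_mul, tmul_mul]
    have hx := hn v β h
    generalize u' * (a * u) = b
    generalize x * path K E v β = y at hx
    induction hx using Submodule.span_induction generalizing b with
    | mem _ hz =>
      obtain ⟨⟨w, p⟩, rfl⟩ := hz
      by_cases h : v' = w
      · subst h
        exact ⟨[(b, p)], by simp [pathPoly, vertex_mul_path]⟩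
      · exact ⟨[], by simp [pathPoly, vertex_mul_path_ne h]⟩
    | zero => exact ⟨[], by simp [pathPoly]⟩
    | add y z _ _ hy hz =>
      obtain ⟨l₁, h₁⟩ := hy b
      obtain ⟨l₂, h₂⟩ := hz b
      exact ⟨l₁ ++ l₂, by rw [mul_add, TensorProduct.tmul_add, h₁, h₂, pathPoly_append]⟩
    | smul k y _ hy =>
      obtain ⟨l, hl⟩ := hy (k • b)
      exact ⟨l, by rw [← hl, mul_smul_comm, TensorProduct.smul_tmul]⟩

/-- The ghost e* removes the first edge of the terms beginning with e and kills the others, so the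
degree drops. A constant term is excluded because it would leave a ghost edge behind. -/
theorem exists_ghost_mul_pathPoly (u : A) (e : W) {n : ℕ} (l : List (A × List W))
    (hl : ∀ t ∈ l, t.2 ≠ [] ∧ t.2.length ≤ n + 1) : ∃ l' : List (A × List W),
      (u ⊗ₜ[K] ghost K E e) * pathPoly K E (E.s e) l = pathPoly K E (E.r e) l' ∧
      ∀ t ∈ l', t.2.length ≤ n := by
  induction l with
  | nil => exact ⟨[], by simp [pathPoly], by simp⟩
  | cons t l ih =>
    obtain ⟨l', h, h'⟩ := ih fun t ht => hl t (List.mem_cons_of_mem _ ht)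
    obtain ⟨b, p⟩ := t
    obtain ⟨h₁, h₂⟩ := hl (b, p) (by simp)
    cases p with
    | nil => exact absurd rfl h₁
    | cons f p =>
      rw [pathPoly_cons, mul_add, h, tmul_mul, path, ← mul_assoc, ghost_mul_source, ← mul_assoc]
      by_cases hef : e = f
      · subst hef
        refine ⟨(u * b, p) :: l', ?_, ?_⟩
        · rw [pathPoly_cons, ghost_mul_self, vertex_mul_path]
        · intro s hs
          rcases List.mem_cons.1 hs with rfl | hs
          · simpa using h₂
          · exact h' s hs
      · exact ⟨l', by rw [ghost_mul_ne hef]; simp, h'⟩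

/-- Stripping initial edges off a polynomial until its constant term is outside the ideal. -/
theorem exists_constant_term (hA : IsSUnital A) (hE : E.RowFinite) (hs : ∀ v, ∃ e, E.s e = v)
    {N : TwoSidedIdeal (A ⊗[K] LeavittPathAlgebra K E)} (n : ℕ) (v : V) (l : List (A × List W))
    (hl : ∀ t ∈ l, t.2.length ≤ n) (h : pathPoly K E v l ∉ N) :
    ∃ (y : A ⊗[K] LeavittPathAlgebra K E) (b : A) (w : V) (l' : List (A × List W)),
      y * pathPoly K E v l - (b ⊗ₜ[K] vertex K E w + pathPoly K E w l') ∈ N ∧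
      b ⊗ₜ[K] vertex K E w ∉ N ∧ ∀ t ∈ l', t.2 ≠ [] := by
  induction n generalizing v l with
  | zero =>
    obtain ⟨b, l', h₁, h₂⟩ := exists_pathPoly_eq_add (K := K) (E := E) v l hl
    have : l' = [] := List.eq_nil_iff_forall_not_mem.2 fun t ht =>
      (h₂ t ht).1 (List.length_eq_zero_iff.1 (Nat.le_zero.1 (h₂ t ht).2))
    obtain ⟨u, hu⟩ := exists_vertex_mul_pathPoly (K := K) (E := E) hA v l
    refine ⟨_, b, v, l', by rw [hu, h₁, sub_self]; exact N.zero_mem, ?_, fun t ht => (h₂ t ht).1⟩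
    rw [h₁, this] at h
    simpa [pathPoly] using h
  | succ n ih =>
    obtain ⟨b, l', h₁, h₂⟩ := exists_pathPoly_eq_add (K := K) (E := E) v l hl
    by_cases hb : b ⊗ₜ[K] vertex K E v ∈ N
    -- A constant term in `N` may be dropped. Some ghost edge keeps the remainder outside `N`, for
    -- otherwise v = ∑ e e* would put it in `N`. The new degree is smaller.
    · have h' : pathPoly K E v l' ∉ N := fun h' => h (h₁ ▸ N.add_mem hb h')
      obtain ⟨u, e, he, hu⟩ : ∃ (u : A) (e : W), E.s e = v ∧
          (u ⊗ₜ[K] ghost K E e) * pathPoly K E v l' ∉ N := by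
        by_contra! H
        obtain ⟨u, hu⟩ := exists_vertex_mul_pathPoly (K := K) (E := E) hA v l'
        exact h' (hu ▸ vertex_mul_mem_of_ghost_mul_mem hA hE (hs v) H u)
      subst he
      obtain ⟨l₂, h₃, h₄⟩ := exists_ghost_mul_pathPoly (K := K) u e l' h₂
      rw [h₃] at hu
      obtain ⟨y, c, w, l₃, h₅, h₆, h₇⟩ := ih _ l₂ h₄ hu
      refine ⟨y * (u ⊗ₜ[K] ghost K E e), c, w, l₃, ?_, h₆, h₇⟩
      rw [h₁, mul_add, mul_assoc y _ (pathPoly K E _ l'), h₃, add_sub_assoc]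
      exact N.add_mem (N.mul_mem_left _ _ hb) h₅
    · obtain ⟨u, hu⟩ := exists_vertex_mul_pathPoly (K := K) (E := E) hA v l
      exact ⟨_, b, v, l', by rw [hu, h₁, sub_self]; exact N.zero_mem, hb, fun t ht => (h₂ t ht).1⟩

theorem not_append_prefix {p : List W} (hp : p ≠ []) (τ : List W) : ¬ p ++ τ <+: τ := fun h =>
  hp (by simpa using h.length_le)

/-- Conjugating a nontrivial path by a path gives zero or a nontrivial path. -/
theorem conj_path {v w : V} {τ : List W} (hτ : E.IsPath v τ w) {p : List W} (hp : p ≠ []) :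
    ghostPath K E v τ * (path K E v p * path K E v τ) = 0 ∨
      ∃ ρ, ρ ≠ [] ∧ ghostPath K E v τ * (path K E v p * path K E v τ) = path K E w ρ := by
  by_cases hx : ∃ x, E.IsPath v p x
  · obtain ⟨x, hx⟩ := hx
    by_cases hxv : x = v
    · subst hxv
      rw [path_mul_path hx]
      by_cases hpre : τ <+: p ++ τ
      · obtain ⟨ρ, hρ⟩ := hpre
        refine .inr ⟨ρ, ?_, by rw [← hρ, ghostPath_mul_path_append hτ]⟩
        rintro rfl
        exact hp (by simpa using hρ)
      · exact .inl (ghostPath_mul_path_eq_zero hpre (not_append_prefix hp τ))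
    · exact .inl (by rw [path_mul_path_ne hx hxv, mul_zero])
  · exact .inl (by rw [path_eq_zero hx, zero_mul, mul_zero])

/-- If p is closed at v, choose τ that is not a prefix of p ++ τ; then the two lists are
incomparable and τ* p τ = 0. If p is not closed at v, the trivial path already kills it. -/
theorem exists_conj_path_eq_zero {w : V} (hw : E.IsBranchingHub w) (v : V) {p : List W}
    (hp : p ≠ []) : ∃ τ x, E.IsPath v τ x ∧
      ghostPath K E v τ * (path K E v p * path K E v τ) = 0 := by
  by_cases hx : E.IsPath v p v
  · obtain ⟨τ, x, hτ, hpre⟩ := hw.exists_path_not_prefix v hp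
    exact ⟨τ, x, hτ, by
      rw [path_mul_path hx, ghostPath_mul_path_eq_zero hpre (not_append_prefix hp τ)]⟩
  · refine ⟨[], v, rfl, ?_⟩
    by_cases h : ∃ x, E.IsPath v p x
    · obtain ⟨x, h⟩ := h
      rw [path_mul_path_ne h (fun hxv => hx (by rwa [hxv] at h)), mul_zero]
    · rw [path_eq_zero h, zero_mul, mul_zero]

/-- The number of terms is the induction measure in `exists_conj_eq_constant`, and conjugation never
increases it or creates a constant term. -/
theorem exists_conj_pathPoly {v w : V} {τ : List W} (hτ : E.IsPath v τ w) (u u' : A)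
    (l : List (A × List W)) (hl : ∀ t ∈ l, t.2 ≠ []) : ∃ l' : List (A × List W),
      (u ⊗ₜ[K] ghostPath K E v τ) * (pathPoly K E v l * (u' ⊗ₜ[K] path K E v τ)) =
        pathPoly K E w l' ∧ (∀ t ∈ l', t.2 ≠ []) ∧ l'.length ≤ l.length := by
  induction l with
  | nil => exact ⟨[], by simp [pathPoly], by simp, le_rfl⟩
  | cons t l ih =>
    obtain ⟨l', h₁, h₂, h₃⟩ := ih fun t ht => hl t (List.mem_cons_of_mem _ ht)
    rw [pathPoly_cons, add_mul, mul_add, h₁, tmul_mul, tmul_mul]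
    rcases conj_path (K := K) hτ (hl t (by simp)) with h | ⟨ρ, hρ, h⟩
    · exact ⟨l', by rw [h]; simp, h₂, h₃.trans (by simp)⟩
    · refine ⟨(u * (t.1 * u'), ρ) :: l', by rw [h, pathPoly_cons], ?_, by simpa using h₃⟩
      intro s hs
      rcases List.mem_cons.1 hs with rfl | hs
      · exact hρ
      · exact h₂ s hs

/-- Conjugating away the nonconstant terms of a polynomial. -/
theorem exists_conj_eq_constant (hA : IsSUnital A) {w : V} (hw : E.IsBranchingHub w) (n : ℕ)
    (b : A) (v : V) (l : List (A × List W)) (hn : l.length ≤ n) (hl : ∀ t ∈ l, t.2 ≠ []) :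
    ∃ y z : A ⊗[K] LeavittPathAlgebra K E,
      y * ((b ⊗ₜ[K] vertex K E v + pathPoly K E v l) * z) = b ⊗ₜ[K] vertex K E w := by
  obtain ⟨u, u', hu, hu'⟩ := hA b
  have conj {x : V} {τ : List W} (hτ : E.IsPath v τ x) : (u ⊗ₜ[K] ghostPath K E v τ) *
      ((b ⊗ₜ[K] vertex K E v) * (u' ⊗ₜ[K] path K E v τ)) = b ⊗ₜ[K] vertex K E x := by
    rw [tmul_mul, tmul_mul, vertex_mul_path, ghostPath_mul_path_self hτ, hu', hu]
  induction n generalizing v l with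
  | zero =>
    obtain rfl : l = [] := List.length_eq_zero_iff.1 (Nat.le_zero.1 hn)
    obtain ⟨τ, hτ⟩ := hw.connects v
    exact ⟨_, _, by rw [pathPoly, List.map_nil, List.sum_nil, add_zero]; exact conj hτ⟩
  | succ n ih =>
    cases l with
    | nil =>
      obtain ⟨τ, hτ⟩ := hw.connects v
      exact ⟨_, _, by rw [pathPoly, List.map_nil, List.sum_nil, add_zero]; exact conj hτ⟩
    | cons t l =>
      -- This conjugation kills the leading term and carries b ⊗ v to b ⊗ x, so at least one
      -- nonconstant term disappears while the coefficient b is kept.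
      obtain ⟨τ, x, hτ, h₀⟩ := exists_conj_path_eq_zero (K := K) hw v (hl t (by simp))
      obtain ⟨l', h₁, h₂, h₃⟩ := exists_conj_pathPoly (K := K) hτ u u' l
        fun t ht => hl t (List.mem_cons_of_mem _ ht)
      obtain ⟨y, z, hyz⟩ := ih x l' (h₃.trans (by simpa using hn)) h₂ fun {x' τ'} hτ' => by
        rw [tmul_mul, tmul_mul, vertex_mul_path, ghostPath_mul_path_self hτ', hu', hu]
      refine ⟨y * (u ⊗ₜ[K] ghostPath K E v τ), (u' ⊗ₜ[K] path K E v τ) * z, ?_⟩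
      rw [← hyz, mul_assoc, ← mul_assoc _ _ z, ← mul_assoc _ _ z, pathPoly_cons, add_mul, add_mul,
        mul_add, mul_add, conj hτ, h₁, tmul_mul, tmul_mul, h₀, TensorProduct.tmul_zero, zero_add]

/-- Modulo an ideal, every nonzero element is compressed to a nonzero element of `A ⊗ w`. -/
theorem exists_compression (hA : IsSUnital A) (hE : E.RowFinite) (hs : ∀ v, ∃ e, E.s e = v)
    (h_simple : ∀ H : Set V, E.IsHereditary H → E.IsSaturated H → H = ∅ ∨ H = Set.univ)
    {w : V} (hw : E.IsBranchingHub w) {N : TwoSidedIdeal (A ⊗[K] LeavittPathAlgebra K E)}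
    {x : A ⊗[K] LeavittPathAlgebra K E} (hx : x ∉ N) :
    ∃ (y z : A ⊗[K] LeavittPathAlgebra K E) (b : A),
      y * x * z - b ⊗ₜ[K] vertex K E w ∈ N ∧ b ⊗ₜ[K] vertex K E w ∉ N := by
  obtain ⟨n, hn⟩ := exists_mul_path_eq_pathPoly x
  obtain ⟨u, v, β, hβ, h₁⟩ : ∃ (u : A) (v : V) (β : List W), β.length = n ∧
      x * (u ⊗ₜ[K] path K E v β) ∉ N := by
    by_contra! H
    exact hx (mem_of_mul_path_mem hA hE hs n H)
  obtain ⟨u', v', h₂⟩ : ∃ (u' : A) (v' : V),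
      (u' ⊗ₜ[K] vertex K E v') * (x * (u ⊗ₜ[K] path K E v β)) ∉ N := by
    by_contra! H
    exact h₁ (mem_of_vertex_mul_mem hA H)
  obtain ⟨l, hl⟩ := hn u v β hβ.ge u' v'
  obtain ⟨m, hm⟩ : ∃ m, ∀ t ∈ l, t.2.length ≤ m :=
    ⟨(l.map fun t => t.2.length).sum, fun t ht =>
      List.single_le_sum (fun _ _ => Nat.zero_le _) _ (List.mem_map_of_mem ht)⟩
  rw [hl] at h₂
  obtain ⟨y, b, w', l', h₃, h₄, h₅⟩ := exists_constant_term hA hE hs m v' l hm h₂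
  obtain ⟨y', z, h₆⟩ := exists_conj_eq_constant (K := K) hA hw l'.length b w' l' le_rfl h₅
  refine ⟨y' * (y * (u' ⊗ₜ[K] vertex K E v')), (u ⊗ₜ[K] path K E v β) * z, b, ?_,
    fun h => h₄ (tmul_vertex_mem hA hE h_simple h w')⟩
  have := N.mul_mem_left y' _ (N.mul_mem_right _ z h₃)
  rw [sub_mul, mul_sub, h₆, ← hl] at this
  simpa only [mul_assoc] using this

/-- The ideal of coefficients of a vertex. -/
noncomputable def coefficientIdeal (N : TwoSidedIdeal (A ⊗[K] LeavittPathAlgebra K E)) (w : V) :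
    TwoSidedIdeal A :=
  TwoSidedIdeal.mk' {b | b ⊗ₜ[K] vertex K E w ∈ N}
    (by simp [N.zero_mem])
    (fun hx hy => by
      change _ ∈ N
      rw [TensorProduct.add_tmul]
      exact N.add_mem hx hy)
    (fun hx => by
      change _ ∈ N
      rw [TensorProduct.neg_tmul]
      exact N.neg_mem hx)
    (fun {x y} hy => by
      change _ ∈ N
      rw [← vertex_mul_self, ← tmul_mul]
      exact N.mul_mem_left _ _ hy)
    (fun {x y} hx => by
      change _ ∈ N
      rw [← vertex_mul_self, ← tmul_mul]
      exact N.mul_mem_right _ _ hx)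

theorem mem_coefficientIdeal {N : TwoSidedIdeal (A ⊗[K] LeavittPathAlgebra K E)} {w : V} {b : A} :
    b ∈ coefficientIdeal N w ↔ b ⊗ₜ[K] vertex K E w ∈ N := by
  rw [coefficientIdeal, TwoSidedIdeal.mem_mk']
  rfl

end LeavittPathAlgebra

/-- If right ideals modulo `I` contain idempotents, elements outside `I` have right multiples that
are idempotent modulo `I` and outside `I`. -/
theorem RightIdealsHaveIdempotents.exists_mul {A : Type*} [NonUnitalRing A] (hA : IsSUnital A)
    {I : TwoSidedIdeal A} (h : RightIdealsHaveIdempotents I.ringCon.Quotient) {c : A} (hc : c ∉ I) :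
    ∃ d, c * d ∉ I ∧ c * d * (c * d) - c * d ∈ I := by
  -- The right ideal is the image of cA, which is nonzero because c = c v for some v.
  let J : AddSubgroup I.ringCon.Quotient :=
    { carrier := {x | ∃ d : A, ((c * d : A) : I.ringCon.Quotient) = x}
      zero_mem' := ⟨0, by rw [mul_zero, RingCon.coe_zero]⟩
      add_mem' := by
        rintro _ _ ⟨d, rfl⟩ ⟨d', rfl⟩
        exact ⟨d + d', by rw [mul_add, RingCon.coe_add]⟩
      neg_mem' := by
        rintro _ ⟨d, rfl⟩
        exact ⟨-d, by rw [mul_neg, RingCon.coe_neg]⟩ }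
  obtain ⟨_, ⟨d, rfl⟩, he, hee⟩ := h J
    (by
      rintro _ ⟨d, rfl⟩ r
      induction r using Quotient.inductionOn' with | _ r
      exact ⟨d * r, by rw [← mul_assoc]; rfl⟩)
    (fun hJ => hc (by
      obtain ⟨-, v, -, hv⟩ := hA c
      have : (c : I.ringCon.Quotient) ∈ J := ⟨v, by rw [hv]⟩
      rwa [hJ, AddSubgroup.mem_bot, I.coe_eq_zero_iff] at this))
  rw [Ne, I.coe_eq_zero_iff] at he
  rw [← RingCon.coe_mul, I.coe_eq_coe_iff] at hee
  exact ⟨d, he, hee⟩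

/-! ### The properly infinite idempotent at the hub. -/

open LeavittPathAlgebra in
theorem mainTheorem5 {K : Type*} [Field K]
    {A : Type*} [NonUnitalRing A] [Module K A] [IsScalarTower K A A] [SMulCommClass K A A]
    {V W : Type*} [Countable V] [Countable W] (E : DirectedGraph V W)
    (hA : IsSUnital A)
    (hE : E.RowFinite)
    (h_idem : ∀ I : TwoSidedIdeal A, RightIdealsHaveIdempotents I.ringCon.Quotient)
    (h_simple : ∀ H : Set V, E.IsHereditary H → E.IsSaturated H → H = ∅ ∨ H = Set.univ)
    (h_exit : ∀ p : List W, E.IsCycle p → ∃ e, E.IsExit e p)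
    (h_cycle : ∀ v : V, E.ConnectsToCycle v) :
    IsProperlyPurelyInfinite (A ⊗[K] LeavittPathAlgebra K E) := by
  refine isProperlyPurelyInfinite_of_idempotents (isSUnital_tensor hA) fun N x hx => ?_
  have hs := DirectedGraph.exists_emits h_cycle
  -- Without vertices every element lies in `N`.
  have : Nonempty V := by
    by_contra hV
    exact hx (mem_of_mul_vertex_mem hA fun u v => absurd ⟨v⟩ hV)
  obtain ⟨w, hw⟩ := DirectedGraph.exists_isBranchingHub h_simple h_exit h_cycle
  obtain ⟨σ₁, σ₂, hσ₁, hσ₂, h₁₂, h₂₁⟩ := hw.exists_closed_paths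
  obtain ⟨y, z, c, hc, hcN⟩ := exists_compression hA hE hs h_simple hw hx
  obtain ⟨d, he, hee⟩ := (h_idem (coefficientIdeal N w)).exists_mul hA
    (mem_coefficientIdeal.not.2 hcN)
  rw [mem_coefficientIdeal] at he hee
  set e := c * d
  -- Since (e² - e) ⊗ w ∈ `N`, the coefficient e is idempotent modulo `N` in front of any multiple
  -- of w.
  have key (l : LeavittPathAlgebra K E) (l' : LeavittPathAlgebra K E)
      (hl : vertex K E w * l = l' ∨ l * vertex K E w = l') :
      (((e * e) ⊗ₜ[K] l' : A ⊗[K] LeavittPathAlgebra K E) : N.ringCon.Quotient) =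
        (e ⊗ₜ[K] l' : A ⊗[K] LeavittPathAlgebra K E) := by
    rw [N.coe_eq_coe_iff, ← TensorProduct.sub_tmul]
    rcases hl with rfl | rfl
    · exact tmul_mul_mem hA hee l
    · exact tmul_mul_mem_left hA hee l
  -- The factor d ⊗ w turns c ⊗ w into e ⊗ w. The maps are s_i = e ⊗ σ_i and t_i = e ⊗ σ_i*, with
  -- t_i s_j ≡ δ_ij e ⊗ w because σ₁ and σ₂ are incomparable closed paths at w.
  refine ⟨y, ↑(z * (d ⊗ₜ[K] vertex K E w)), ↑(e ⊗ₜ[K] vertex K E w), ↑(e ⊗ₜ[K] path K E w σ₁),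
    ↑(e ⊗ₜ[K] path K E w σ₂), ↑(e ⊗ₜ[K] ghostPath K E w σ₁), ↑(e ⊗ₜ[K] ghostPath K E w σ₂),
    (N.coe_eq_zero_iff _).not.2 he, ?_, ?_, ?_, ?_, ?_, ?_, ?_, ?_, ?_, ?_⟩
  · rw [← RingCon.coe_mul, ← RingCon.coe_mul, N.coe_eq_coe_iff]
    have := N.mul_mem_right _ (d ⊗ₜ[K] vertex K E w) hc
    rwa [sub_mul, tmul_mul, vertex_mul_self, mul_assoc (y * x)] at this
  all_goals rw [← RingCon.coe_mul, tmul_mul]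
  · rw [vertex_mul_self]
    exact key _ _ (.inl (vertex_mul_self w))
  · rw [vertex_mul_path]
    exact key _ _ (.inl (vertex_mul_path w _))
  · rw [vertex_mul_path]
    exact key _ _ (.inl (vertex_mul_path w _))
  · rw [ghostPath_mul_vertex]
    exact key _ _ (.inr (ghostPath_mul_vertex w _))
  · rw [ghostPath_mul_vertex]
    exact key _ _ (.inr (ghostPath_mul_vertex w _))
  · rw [ghostPath_mul_path_self hσ₁]
    exact key _ _ (.inl (vertex_mul_self w))
  · rw [ghostPath_mul_path_eq_zero h₁₂ h₂₁, TensorProduct.tmul_zero, RingCon.coe_zero]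
  · rw [ghostPath_mul_path_eq_zero h₂₁ h₁₂, TensorProduct.tmul_zero, RingCon.coe_zero]
  · rw [ghostPath_mul_path_self hσ₂]
    exact key _ _ (.inl (vertex_mul_self w))
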